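/- Let $\mathscr G=(\mathscr V,\mathscr E)$ be a finite simple graph, let $\{\Gamma_v\}_{v\in\mathscr V}$ be infinite groups, and let $\Gamma=\mathscr G\{\Gamma_v\}$ be their graph product, i.e. the quotient of the free product $\ast_{v\in\mathscr V}\Gamma_v$ by the relations $[\Gamma_u,\Gamma_v]=1$ for all $(u,v)\in\mathscr E$. For $\mathscr U\subseteq\mathscr V$ let $\Gamma_{\mathscr U}=\langle\Gamma_u : u\in\mathscr U\rangle\le\Gamma$, and let ${\rm lk}(\mathscr U)$ be the set of vertices of $\mathscr G$ that are adjacent to every $u\in\mathscr U$ (so ${\rm lk}(\emptyset)=\mathscr V$). Let ${\rm L}(\Gamma)\subseteq B(\ell^2(\Gamma))$ be the group von Neumann algebra of $\Gamma$, generated by the left translation unitaries $u_g$, $g\in\Gamma$, and for a subgroup $H\le\Gamma$ let ${\rm L}(H)=\{u_h : h\in H\}''\subseteq{\rm L}(\Gamma)$. Let $\mathscr S,\mathscr T\subseteq\mathscr V$, and suppose that there are $x,x_1,\dots,x_n\in {\rm L}(\Gamma)$ with $x\neq 0$ and $${\rm L}(\Gamma_{\mathscr S})\,x\subseteq\sum_{k=1}^n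 x_k\,{\rm L}(\Gamma_{\mathscr T}).$$ Then $\mathscr S\subseteq\mathscr T$ and $x\in {\rm L}(\Gamma_{\mathscr T\cup{\rm lk}(\mathscr S)})$. -/

import Mathlib

open scoped ENNReal

/-! ### Graph products of groups -/

/-- The commutators `[a, b] = a b a⁻¹ b⁻¹` in the free product of the vertex groups, for `a`, `b` in the vertex
groups of two adjacent vertices. -/
def graphProductRelators {V : Type*} (G : SimpleGraph V) (Γ : V → Type*) [∀ v, Group (Γ v)] :
    Set (Monoid.CoprodI Γ) :=
  {r | ∃ (u v : V) (a : Γ u) (b : Γ v), G.Adj u v ∧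
    r = Monoid.CoprodI.of a * Monoid.CoprodI.of b * (Monoid.CoprodI.of a)⁻¹ *
      (Monoid.CoprodI.of b)⁻¹}

/-- The graph product group: the free product of the vertex groups modulo the relations
`[Γ u, Γ v] = 1` for adjacent `u` and `v`. -/
abbrev GraphProduct {V : Type*} (G : SimpleGraph V) (Γ : V → Type*) [∀ v, Group (Γ v)] :=
  Monoid.CoprodI Γ ⧸ Subgroup.normalClosure (graphProductRelators G Γ)

/-- The canonical homomorphism of a vertex group to the graph product. -/
def GraphProduct.of {V : Type*} (G : SimpleGraph V) (Γ : V → Type*) [∀ v, Group (Γ v)] (v : V) :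
    Γ v →* GraphProduct G Γ :=
  (QuotientGroup.mk' (Subgroup.normalClosure (graphProductRelators G Γ))).comp Monoid.CoprodI.of

/-- The full subgroup of the graph product on a set `U` of vertices: the subgroup generated by the
vertex groups `Γ u`, `u ∈ U`. -/
def GraphProduct.full {V : Type*} (G : SimpleGraph V) (Γ : V → Type*) [∀ v, Group (Γ v)]
    (U : Set V) : Subgroup (GraphProduct G Γ) :=
  ⨆ u ∈ U, (GraphProduct.of G Γ u).range

/-- The link of a set of vertices: the vertices adjacent to all its members (so the link of the
empty set is everything). -/
def graphLink {V : Type*} (G : SimpleGraph V) (U : Set V) : Set V :=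
  {w | ∀ u ∈ U, G.Adj u w}

/-! ### Group von Neumann algebras -/

/-- The Hilbert space `ℓ²(K)` of a (discrete) group. -/
noncomputable abbrev EllTwo (K : Type*) := lp (fun _ : K => ℂ) 2

theorem memlp_two_translate {K : Type*} [Group K] (g : K) (ξ : EllTwo K) :
    Memℓp (fun h : K => ξ (g⁻¹ * h)) 2 := by
  have h := lp.memℓp ξ
  rw [memℓp_gen_iff (by norm_num)] at h ⊢
  exact (Equiv.mulLeft g⁻¹).summable_iff.mpr h

/-- Left translation by `g` on `ℓ²(K)`, `(λ_g ξ)(h) = ξ(g⁻¹h)`, as an isometry. -/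
noncomputable def leftTranslation {K : Type*} [Group K] (g : K) : EllTwo K →ₗᵢ[ℂ] EllTwo K where
  toFun ξ := ⟨fun h => ξ (g⁻¹ * h), memlp_two_translate g ξ⟩
  map_add' ξ η := by ext h; rfl
  map_smul' c ξ := by ext h; rfl
  norm_map' ξ := by
    rw [lp.norm_eq_tsum_rpow (by norm_num), lp.norm_eq_tsum_rpow (by norm_num)]
    congr 1
    exact (Equiv.mulLeft g⁻¹).tsum_eq (fun h => ‖ξ h‖ ^ (2 : ℝ≥0∞).toReal)

/-- The left regular representation of a group `K` on `ℓ²(K)`. -/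
noncomputable def leftRegularRep (K : Type*) [Group K] : K →* (EllTwo K →L[ℂ] EllTwo K) where
  toFun g := (leftTranslation g).toContinuousLinearMap
  map_one' := by
    ext ξ h
    change ξ (1⁻¹ * h) = ξ h
    simp
  map_mul' a b := by
    ext ξ h
    change ξ ((a * b)⁻¹ * h) = ξ (b⁻¹ * (a⁻¹ * h))
    simp [mul_assoc]

@[simp]
theorem leftRegularRep_apply {K : Type*} [Group K] (g : K) (ξ : EllTwo K) (h : K) :
    leftRegularRep K g ξ h = ξ (g⁻¹ * h) := rfl

theorem star_leftRegularRep {K : Type*} [Group K] (g : K) :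
    star (leftRegularRep K g) = leftRegularRep K g⁻¹ := by
  rw [ContinuousLinearMap.star_eq_adjoint]
  symm
  rw [ContinuousLinearMap.eq_adjoint_iff]
  intro ξ η
  rw [lp.inner_eq_tsum, lp.inner_eq_tsum, ← (Equiv.mulLeft g).tsum_eq
    (fun h => inner ℂ (ξ h) (leftRegularRep K g η h))]
  simp

/-- For a subgroup `H` of `K`, the von Neumann subalgebra `L(H)` of `L(K)`, acting on `ℓ²(K)`:
the von Neumann algebra generated by the unitaries `λ_h`, `h ∈ H` (see
`coe_subgroupVN`: its underlying set is the double commutant of these). -/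
noncomputable def subgroupVN {K : Type*} [Group K] (H : Subgroup K) :
    VonNeumannAlgebra (EllTwo K) where
  toStarSubalgebra := StarSubalgebra.centralizer ℂ
    (StarSubalgebra.centralizer ℂ (leftRegularRep K '' H) : Set (EllTwo K →L[ℂ] EllTwo K))
  centralizer_centralizer' := by simp

theorem coe_subgroupVN {K : Type*} [Group K] (H : Subgroup K) :
    (subgroupVN H : Set (EllTwo K →L[ℂ] EllTwo K)) =
      Set.centralizer (Set.centralizer (leftRegularRep K '' H)) := by
  have hs : star (leftRegularRep K '' (H : Set K)) = leftRegularRep K '' H := by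
    ext y
    rw [Set.mem_star]
    constructor
    · rintro ⟨g, hg, hy⟩
      exact ⟨g⁻¹, H.inv_mem hg, by rw [← star_leftRegularRep, hy, star_star]⟩
    · rintro ⟨g, hg, rfl⟩
      exact ⟨g⁻¹, H.inv_mem hg, (star_leftRegularRep g).symm⟩
  have h1 : (StarSubalgebra.centralizer ℂ (leftRegularRep K '' (H : Set K)) :
      Set (EllTwo K →L[ℂ] EllTwo K)) = Set.centralizer (leftRegularRep K '' H) := by
    rw [StarSubalgebra.coe_centralizer, hs, Set.union_self]
  have h2 : (StarSubalgebra.centralizer ℂ (StarSubalgebra.centralizer ℂ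
      (leftRegularRep K '' (H : Set K)) : Set (EllTwo K →L[ℂ] EllTwo K)) :
      Set (EllTwo K →L[ℂ] EllTwo K)) =
      Set.centralizer (StarSubalgebra.centralizer ℂ (leftRegularRep K '' (H : Set K))) := by
    rw [StarSubalgebra.coe_centralizer, StarMemClass.star_coe_eq, Set.union_self]
  rw [← h1]
  exact h2

/-- The group von Neumann algebra `L(K)`, acting on `ℓ²(K)`. -/
noncomputable def groupVN (K : Type*) [Group K] : VonNeumannAlgebra (EllTwo K) :=
  subgroupVN (⊤ : Subgroup K)

/-! The Fourier coefficient of `x` at `g` equals that of `u_h x` at `h g`. For `h` in the group on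
`S`, write `u_h x = ∑ x_k b_k`; the open mapping theorem lets the `b_k` be chosen with norms bounded
independently of `h`. If the orbit of the coset of `g` modulo the group on `T` is infinite, then the
coset of `h g` can avoid any finite set carrying almost all the `ℓ²`-mass of the `x_k`, and
Cauchy–Schwarz makes the coefficient arbitrarily small. Hence a nonzero coefficient forces a finite
orbit (`finite_orbit_of_coeff_ne_zero`).

The rest is group theory (`subset_and_mem_of_finite_orbit`). For `s ∈ S`, pigeonhole in the infinite
group `Γ s` gives a nontrivial `a` with `g⁻¹ a g` in the group on `T`. Projecting to `Γ s` shows `s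
∈ T`, and retracting to `T` writes `g` as an element centralizing `a` times an element of the group
on `T`.

The centralizer of `a` lies in the group on the star of `s`: the graph product embeds in the
semidirect product of `Γ s` with an amalgam of copies, indexed by `Γ s`, of the group on the other
vertices, amalgamated over the group on the neighbors of `s`. There `a` shifts the indices without
fixed points, so by normal forms it fixes only the amalgamated subgroup. Intersecting over `s ∈ S`
leaves the vertices of `T` and of the link of `S`. -/

/-! ### Fixed points of index shifts on amalgamated products -/

namespace Monoid.PushoutI

variable {ι G H : Type*} [Group G] [Group H] {φ : H →* G}

/-- The endomorphism of an amalgamated product of copies of one group induced by a map of the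
index set. -/
def shift (φ : H →* G) (σ : ι → ι) :
    PushoutI (fun _ : ι => φ) →* PushoutI (fun _ : ι => φ) :=
  lift (G := fun _ : ι => G) (φ := fun _ : ι => φ)
    (fun i => of (G := fun _ : ι => G) (φ := fun _ : ι => φ) (σ i)) (base _)
    fun i => of_comp_eq_base (G := fun _ : ι => G) (φ := fun _ : ι => φ) (σ i)

@[simp]
theorem shift_of (σ : ι → ι) (i : ι) (g : G) :
    shift φ σ (of i g) = of (φ := fun _ : ι => φ) (σ i) g :=
  lift_of (G := fun _ : ι => G) (φ := fun _ : ι => φ) _ _ _ _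

@[simp]
theorem shift_base (σ : ι → ι) (h : H) :
    shift φ σ (base _ h) = base (fun _ : ι => φ) h :=
  lift_base (G := fun _ : ι => G) (φ := fun _ : ι => φ) _ _ _ _

theorem shift_comp (σ τ : ι → ι) : (shift φ σ).comp (shift φ τ) = shift φ (σ ∘ τ) := by
  refine hom_ext (fun i => ?_) ?_
  · ext g; simp
  · ext g; simp

theorem shift_id : shift φ (id : ι → ι) = MonoidHom.id _ := by
  refine hom_ext (fun i => ?_) ?_
  · ext g; simp
  · ext g; simp

theorem shift_ofCoprodI (σ : ι → ι) (l : List (Σ _ : ι, G)) :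
    shift φ σ (ofCoprodI (l.map fun p => CoprodI.of (M := fun _ : ι => G) (i := p.1) p.2).prod) =
      ofCoprodI ((l.map fun p => (⟨σ p.1, p.2⟩ : Σ _ : ι, G)).map
        fun p => CoprodI.of (M := fun _ : ι => G) (i := p.1) p.2).prod := by
  induction l with
  | nil => simp
  | cons p l ih => simp only [List.map_cons, List.prod_cons, map_mul, ih, ofCoprodI_of, shift_of]

/-- If an injective map of the index set has no fixed points, then the fixed points of the
induced endomorphism of the amalgamated product lie in the base group. -/
theorem mem_range_base_of_shift_eq (hφ : Function.Injective φ) {σ : ι → ι}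
    (hσ : Function.Injective σ) (hσ' : ∀ i, σ i ≠ i) {p : PushoutI (fun _ : ι => φ)}
    (hp : shift φ σ p = p) : p ∈ (base (fun _ : ι => φ)).range := by
  classical
  -- One transversal serves all the copies, so relabeling the indices keeps a word normalized.
  obtain ⟨t, ht, ht1⟩ := φ.range.exists_isComplement_right 1
  let d : NormalWord.Transversal (fun _ : ι => φ) :=
    ⟨fun _ => hφ, fun _ => t, fun _ => ht1, fun _ => ht⟩
  obtain ⟨w, rfl⟩ : ∃ w : NormalWord d, w.prod = p :=
    ⟨NormalWord.equiv p, NormalWord.equiv.symm_apply_apply p⟩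
  -- Relabeling by `σ` gives a normal word for the shifted element; injectivity of `σ` keeps
  -- consecutive indices distinct.
  let w' : NormalWord d :=
    { toList := w.toList.map fun p => ⟨σ p.1, p.2⟩
      ne_one := by
        intro l hl
        obtain ⟨q, hq, rfl⟩ := List.mem_map.1 hl
        exact w.ne_one q hq
      chain_ne := by
        rw [List.isChain_map]
        exact w.chain_ne.imp fun a b h => hσ.ne h
      head := w.head
      normalized := by
        intro i g hl
        obtain ⟨q, hq, h⟩ := List.mem_map.1 hl
        cases h
        exact w.normalized q.1 q.2 hq }
  have h1 : w'.prod = w.prod := by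
    rw [← hp]
    simp only [NormalWord.prod, map_mul, shift_base]
    congr 1
    exact (shift_ofCoprodI σ w.toList).symm
  have h2 : w' = w := NormalWord.prod_injective h1
  have h3 : w.toList.map (fun p => (⟨σ p.1, p.2⟩ : Σ _ : ι, G)) = w.toList :=
    congrArg (fun v : NormalWord d => v.toList) h2
  -- By uniqueness of normal forms the relabeled word is `w` itself, so a first letter would have an
  -- index fixed by `σ`.
  have h4 : w.toList = [] := by
    rcases hl : w.toList with _ | ⟨q, l⟩
    · rfl
    · rw [hl, List.map_cons, List.cons.injEq] at h3
      exact absurd (congrArg Sigma.fst h3.1) (hσ' _)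
  refine ⟨w.head, ?_⟩
  simp [NormalWord.prod, CoprodI.Word.prod, h4]

/-- The permutation action of a group on the amalgamated product of copies of one group indexed
by it. -/
def shiftHom (φ : H →* G) (A : Type*) [Group A] :
    A →* MulAut (PushoutI (fun _ : A => φ)) where
  toFun a := MonoidHom.toMulEquiv (shift φ (a * ·)) (shift φ (a⁻¹ * ·))
    (by rw [shift_comp, ← shift_id]; congr 1; ext; simp)
    (by rw [shift_comp, ← shift_id]; congr 1; ext; simp)
  map_one' := by
    ext p
    change shift φ ((1 : A) * ·) p = p
    simp_rw [one_mul]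
    exact DFunLike.congr_fun shift_id p
  map_mul' a b := by
    ext p
    change shift φ (a * b * ·) p = shift φ (a * ·) (shift φ (b * ·) p)
    rw [← MonoidHom.comp_apply, shift_comp]
    congr 2
    ext; simp [mul_assoc]

theorem shiftHom_apply {A : Type*} [Group A] (a : A) (p : PushoutI (fun _ : A => φ)) :
    shiftHom φ A a p = shift φ (a * ·) p := rfl

end Monoid.PushoutI

/-! ### Semidirect products of amalgamated products with their index groups -/

namespace Subgroup

variable {K A : Type*} [Group K] [Group A] {L M : Subgroup K}

/-- The amalgamated product, over the subgroup `L`, of copies of the subgroup `M` indexed by the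
group `A`, extended by `A`. -/
abbrev ShiftSemidirect (h : L ≤ M) (A : Type*) [Group A] : Type _ :=
  Monoid.PushoutI (fun _ : A => inclusion h) ⋊[Monoid.PushoutI.shiftHom (inclusion h) A] A

/-- An element of `L` comes from the base, which every shift fixes. -/
theorem commute_inr_inl_of (h : L ≤ M) (a b : A) (g : M) (hg : (g : K) ∈ L) :
    Commute (SemidirectProduct.inr a : ShiftSemidirect h A)
      (SemidirectProduct.inl (Monoid.PushoutI.of b g)) := by
  have hg' : (Monoid.PushoutI.of b g : Monoid.PushoutI (fun _ : A => inclusion h)) =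
      Monoid.PushoutI.base _ ⟨g, hg⟩ := by
    rw [← Monoid.PushoutI.of_apply_eq_base _ b]
    rfl
  rw [hg', commute_iff_eq, ← mul_inv_eq_iff_eq_mul, ← map_inv, ← SemidirectProduct.inl_aut,
    Monoid.PushoutI.shiftHom_apply, Monoid.PushoutI.shift_base]

/-- The map from the amalgamated product to the ambient group given by the conjugates of `M` by
elements of `A`. -/
noncomputable def ofShiftPushout (h : L ≤ M) (i : A →* K)
    (hi : ∀ a, ∀ l ∈ L, Commute (i a) l) :
    Monoid.PushoutI (fun _ : A => inclusion h) →* K :=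
  Monoid.PushoutI.lift (fun a => (MulAut.conj (i a)).toMonoidHom.comp M.subtype) L.subtype
    fun a => by
      ext g
      simp [(hi a g g.2).eq]

/-- The map from the semidirect product to the ambient group. -/
noncomputable def ofShiftSemidirect (h : L ≤ M) (i : A →* K)
    (hi : ∀ a, ∀ l ∈ L, Commute (i a) l) : ShiftSemidirect h A →* K :=
  SemidirectProduct.lift (ofShiftPushout h i hi) i fun a => by
    refine Monoid.PushoutI.hom_ext_nonempty fun b => ?_
    ext g
    change ofShiftPushout h i hi (Monoid.PushoutI.shift _ (a * ·) (Monoid.PushoutI.of b g)) =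
      i a * ofShiftPushout h i hi (Monoid.PushoutI.of b g) * (i a)⁻¹
    rw [Monoid.PushoutI.shift_of]
    simp only [ofShiftPushout, Monoid.PushoutI.lift_of]
    simp [mul_assoc]

@[simp]
theorem ofShiftSemidirect_inr (h : L ≤ M) (i : A →* K) (hi : ∀ a, ∀ l ∈ L, Commute (i a) l)
    (a : A) : ofShiftSemidirect h i hi (SemidirectProduct.inr a) = i a := by
  simp [ofShiftSemidirect]

@[simp]
theorem ofShiftSemidirect_inl_of (h : L ≤ M) (i : A →* K)
    (hi : ∀ a, ∀ l ∈ L, Commute (i a) l) (a : A) (g : M) :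
    ofShiftSemidirect h i hi (SemidirectProduct.inl (Monoid.PushoutI.of a g)) =
      i a * g * (i a)⁻¹ := by
  simp [ofShiftSemidirect, ofShiftPushout]

theorem ofShiftSemidirect_inl_base (h : L ≤ M) (i : A →* K)
    (hi : ∀ a, ∀ l ∈ L, Commute (i a) l) (l : L) :
    ofShiftSemidirect h i hi (SemidirectProduct.inl (Monoid.PushoutI.base _ l)) = l := by
  simp [ofShiftSemidirect, ofShiftPushout]

/-- If the ambient group embeds in the semidirect product, compatibly with `A`, then the
centralizer of a nontrivial element of `A` is contained in the product of `L` and `A`. -/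
theorem exists_eq_mul_of_commute (h : L ≤ M) (i : A →* K) (hi : ∀ a, ∀ l ∈ L, Commute (i a) l)
    (f : K →* ShiftSemidirect h A) (hf : ∀ g, ofShiftSemidirect h i hi (f g) = g)
    (hfi : ∀ a, f (i a) = SemidirectProduct.inr a) {a : A} (ha : a ≠ 1) {g : K}
    (hg : Commute (i a) g) : ∃ l ∈ L, ∃ b, g = l * i b := by
  -- The left components of the two products are the shift by `a` of `(f g).left` and `(f g).left`
  -- itself, so the latter is a fixed point.
  have hc := congrArg SemidirectProduct.left (hg.map f).eq
  rw [hfi] at hc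
  simp only [SemidirectProduct.mul_left, SemidirectProduct.left_inr, SemidirectProduct.right_inr,
    one_mul, map_one, mul_one] at hc
  obtain ⟨l, hl⟩ := Monoid.PushoutI.mem_range_base_of_shift_eq
    (inclusion_injective h) (mul_right_injective a) (fun i hi => ha (mul_eq_right.1 hi)) hc
  refine ⟨l, l.2, (f g).right, ?_⟩
  conv_lhs => rw [← hf g, ← SemidirectProduct.inl_left_mul_inr_right (f g), ← hl, map_mul,
    ofShiftSemidirect_inl_base, ofShiftSemidirect_inr]

end Subgroup

/-! ### Full subgroups of graph products -/

namespace GraphProduct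

variable {V : Type*} {G : SimpleGraph V} {Γ : V → Type*} [∀ v, Group (Γ v)]

theorem commute_of {u v : V} (h : G.Adj u v) (a : Γ u) (b : Γ v) :
    Commute (of G Γ u a) (of G Γ v b) := by
  have : (QuotientGroup.mk' (Subgroup.normalClosure (graphProductRelators G Γ)))
      (Monoid.CoprodI.of a * Monoid.CoprodI.of b * (Monoid.CoprodI.of a)⁻¹ *
        (Monoid.CoprodI.of b)⁻¹) = 1 :=
    (QuotientGroup.eq_one_iff _).2 (Subgroup.subset_normalClosure ⟨u, v, a, b, h, rfl⟩)
  rw [map_mul, map_mul, map_mul, map_inv, map_inv, mul_inv_eq_one, mul_inv_eq_iff_eq_mul] at this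
  exact this

/-- Homomorphisms of the vertex groups that commute for adjacent vertices define a homomorphism
of the graph product. -/
def lift {M : Type*} [Group M] (f : ∀ v, Γ v →* M)
    (hf : ∀ u v, G.Adj u v → ∀ a b, Commute (f u a) (f v b)) : GraphProduct G Γ →* M :=
  QuotientGroup.lift _ (Monoid.CoprodI.lift f) <| by
    rw [← Subgroup.normalClosure_subset_iff]
    rintro _ ⟨u, v, a, b, h, rfl⟩
    simp only [SetLike.mem_coe, MonoidHom.mem_ker, map_mul, map_inv, Monoid.CoprodI.lift_of]
    rw [(hf u v h a b).eq]
    group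

@[simp]
theorem lift_of {M : Type*} [Group M] (f : ∀ v, Γ v →* M)
    (hf : ∀ u v, G.Adj u v → ∀ a b, Commute (f u a) (f v b)) (v : V) (a : Γ v) :
    lift f hf (of G Γ v a) = f v a := by
  change QuotientGroup.lift _ _ _ (QuotientGroup.mk' _ _) = _
  simp

theorem hom_ext {M : Type*} [Group M] {f g : GraphProduct G Γ →* M}
    (h : ∀ v a, f (of G Γ v a) = g (of G Γ v a)) : f = g := by
  refine QuotientGroup.monoidHom_ext _ (Monoid.CoprodI.ext_hom _ _ fun v => ?_)
  ext a
  exact h v a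

theorem of_mem_full {U : Set V} {v : V} (hv : v ∈ U) (a : Γ v) : of G Γ v a ∈ full G Γ U :=
  (le_iSup₂_of_le (f := fun u (_ : u ∈ U) => (of G Γ u).range) v hv le_rfl) ⟨a, rfl⟩

theorem full_le_iff {U : Set V} {K : Subgroup (GraphProduct G Γ)} :
    full G Γ U ≤ K ↔ ∀ u ∈ U, ∀ a : Γ u, of G Γ u a ∈ K := by
  rw [full, iSup₂_le_iff]
  refine forall₂_congr fun u _ => ⟨fun h a => h ⟨a, rfl⟩, ?_⟩
  rintro h _ ⟨a, rfl⟩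
  exact h a

theorem full_mono {U W : Set V} (h : U ⊆ W) : full G Γ U ≤ full G Γ W :=
  full_le_iff.2 fun _ hu a => of_mem_full (h hu) a

theorem full_univ : full G Γ Set.univ = ⊤ := by
  rw [eq_top_iff]
  -- A homomorphism into the full subgroup which, followed by the inclusion, is the identity on
  -- generators.
  let f : GraphProduct G Γ →* full G Γ Set.univ :=
    lift (fun v => (of G Γ v).codRestrict _ fun a => of_mem_full (Set.mem_univ v) a)
      fun u v h a b => Subtype.ext (commute_of h a b)
  have hf : (Subgroup.subtype _).comp f = MonoidHom.id _ := hom_ext fun v a => by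
    rw [MonoidHom.comp_apply, show f (of G Γ v a) = _ from lift_of _ _ v a]
    rfl
  intro g _
  have h : (f g : GraphProduct G Γ) = g := DFunLike.congr_fun hf g
  exact h ▸ (f g).2

open Classical in
/-- The retraction of the graph product to a full subgroup, killing the other vertex groups. -/
noncomputable def retract (U : Set V) : GraphProduct G Γ →* GraphProduct G Γ :=
  lift (fun v => if v ∈ U then of G Γ v else 1) fun u v h a b => by
    split_ifs
    · exact commute_of h a b
    all_goals simp

theorem retract_of_mem {U : Set V} {v : V} (hv : v ∈ U) (a : Γ v) :
    retract U (of G Γ v a) = of G Γ v a := by simp [retract, hv]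

theorem retract_of_notMem {U : Set V} {v : V} (hv : v ∉ U) (a : Γ v) :
    retract U (of G Γ v a) = 1 := by simp [retract, hv]

theorem retract_eq_self {U : Set V} {g : GraphProduct G Γ} (hg : g ∈ full G Γ U) :
    retract U g = g := by
  have : full G Γ U ≤ (retract U).eqLocus (MonoidHom.id _) :=
    full_le_iff.2 fun _ hu a => retract_of_mem hu a
  exact this hg

theorem retract_mem_inter {U W : Set V} {g : GraphProduct G Γ} (hg : g ∈ full G Γ W) :
    retract U g ∈ full G Γ (U ∩ W) := by
  have : full G Γ W ≤ (full G Γ (U ∩ W)).comap (retract U) := by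
    refine full_le_iff.2 fun v hv a => ?_
    rw [Subgroup.mem_comap]
    by_cases h : v ∈ U
    · rw [retract_of_mem h]
      exact of_mem_full (Set.mem_inter h hv) a
    · rw [retract_of_notMem h]
      exact one_mem _
  exact this hg

/-- The retraction to `U` fixes the group on `U` and carries the group on `W` into the group on `U ∩
W`. -/
theorem mem_full_inter {U W : Set V} {g : GraphProduct G Γ} (hU : g ∈ full G Γ U)
    (hW : g ∈ full G Γ W) : g ∈ full G Γ (U ∩ W) :=
  retract_eq_self hU ▸ retract_mem_inter hW

theorem retract_mem (U : Set V) (g : GraphProduct G Γ) : retract U g ∈ full G Γ U := by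
  have hg : g ∈ full G Γ Set.univ := full_univ (G := G) (Γ := Γ) ▸ Subgroup.mem_top g
  simpa using retract_mem_inter (U := U) hg

theorem mem_full_biInter {ι : Type*} {I : Set ι} (hI : I.Finite) {W : ι → Set V}
    {g : GraphProduct G Γ} (h : ∀ i ∈ I, g ∈ full G Γ (W i)) : g ∈ full G Γ (⋂ i ∈ I, W i) := by
  induction I, hI using Set.Finite.induction_on with
  | empty =>
    simp only [Set.mem_empty_iff_false, Set.iInter_of_empty, Set.iInter_univ, full_univ]
    exact Subgroup.mem_top g
  | insert _ _ ih =>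
    rw [Set.biInter_insert]
    exact mem_full_inter (h _ (Set.mem_insert _ _)) (ih fun i hi => h i (Set.mem_insert_of_mem _ hi))

/-- A vertex group commutes with the full subgroup on the neighbors of the vertex. -/
theorem commute_of_mem_full_neighborSet {s : V} (a : Γ s) {g : GraphProduct G Γ}
    (hg : g ∈ full G Γ (G.neighborSet s)) : Commute (of G Γ s a) g := by
  have : full G Γ (G.neighborSet s) ≤ Subgroup.centralizer {of G Γ s a} := by
    refine full_le_iff.2 fun v hv b => ?_
    rw [Subgroup.mem_centralizer_singleton_iff]
    exact (commute_of hv a b).symm.eq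
  exact (Subgroup.mem_centralizer_singleton_iff.1 (this hg)).symm

open Classical in
/-- The retraction of the graph product to a vertex group. -/
noncomputable def proj (G : SimpleGraph V) (Γ : V → Type*) [∀ v, Group (Γ v)] (s : V) :
    GraphProduct G Γ →* Γ s :=
  lift (fun v => if h : v = s then h ▸ MonoidHom.id (Γ v) else 1) fun u v h a b => by
    by_cases hu : u = s
    · have hv : v ≠ s := fun hv => h.ne (hu.trans hv.symm)
      simp [hv]
    · simp [hu]

@[simp]
theorem proj_of_self (s : V) (a : Γ s) : proj G Γ s (of G Γ s a) = a := by simp [proj]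

theorem proj_of_ne {s v : V} (h : v ≠ s) (a : Γ v) : proj G Γ s (of G Γ v a) = 1 := by
  simp [proj, h]

theorem proj_eq_one {s : V} {U : Set V} (hs : s ∉ U) {g : GraphProduct G Γ}
    (hg : g ∈ full G Γ U) : proj G Γ s g = 1 := by
  have : full G Γ U ≤ (proj G Γ s).ker :=
    full_le_iff.2 fun v hv a => proj_of_ne (fun h => hs (by rwa [← h])) a
  exact this hg

/-! ### Centralizers of vertex group elements -/

theorem full_neighborSet_le (G : SimpleGraph V) (Γ : V → Type*) [∀ v, Group (Γ v)] (s : V) :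
    full G Γ (G.neighborSet s) ≤ full G Γ {s}ᶜ :=
  full_mono fun _ hv h => G.ne_of_adj hv (Set.mem_singleton_iff.1 h).symm

open Classical in
variable (G Γ) in
/-- The vertex groups, mapped to the semidirect product that describes the graph product. -/
noncomputable def toSemidirectVertex (s v : V) :
    Γ v →* Subgroup.ShiftSemidirect (full_neighborSet_le G Γ s) (Γ s) :=
  if h : v = s then SemidirectProduct.inr.comp (h ▸ MonoidHom.id (Γ v))
  else SemidirectProduct.inl.comp ((Monoid.PushoutI.of (1 : Γ s)).comp
    ((of G Γ v).codRestrict (full G Γ {s}ᶜ) fun a => of_mem_full h a))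

theorem toSemidirectVertex_self (s : V) (a : Γ s) :
    toSemidirectVertex G Γ s s a = SemidirectProduct.inr a := by
  simp [toSemidirectVertex]

theorem toSemidirectVertex_ne {s v : V} (h : v ≠ s) (a : Γ v) :
    toSemidirectVertex G Γ s v a = SemidirectProduct.inl
      (Monoid.PushoutI.of (1 : Γ s) ⟨of G Γ v a, of_mem_full h a⟩) := by
  simp only [toSemidirectVertex, dif_neg h]
  rfl

variable (G Γ) in
/-- The graph product, mapped to the semidirect product with a vertex group. -/
noncomputable def toSemidirect (s : V) :
    GraphProduct G Γ →* Subgroup.ShiftSemidirect (full_neighborSet_le G Γ s) (Γ s) :=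
  lift (toSemidirectVertex G Γ s) fun u v h a b => by
    by_cases hu : u = s
    · subst hu
      rw [toSemidirectVertex_self, toSemidirectVertex_ne h.ne']
      exact Subgroup.commute_inr_inl_of _ _ _ _ (of_mem_full h b)
    · by_cases hv : v = s
      · subst hv
        rw [toSemidirectVertex_self, toSemidirectVertex_ne hu]
        exact (Subgroup.commute_inr_inl_of _ _ _ _ (of_mem_full h.symm a)).symm
      · rw [toSemidirectVertex_ne hu, toSemidirectVertex_ne hv]
        refine Commute.map (Commute.map ?_ _) _
        exact Subtype.ext (commute_of h a b)

/-- Only this half of the isomorphism with the semidirect product is needed: it lets centralizers be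
computed there and mapped back. -/
theorem ofShiftSemidirect_toSemidirect (s : V) (g : GraphProduct G Γ) :
    Subgroup.ofShiftSemidirect (full_neighborSet_le G Γ s) (of G Γ s)
      (fun a _ hl => commute_of_mem_full_neighborSet a hl) (toSemidirect G Γ s g) = g := by
  suffices h : (Subgroup.ofShiftSemidirect (full_neighborSet_le G Γ s) (of G Γ s)
      (fun a _ hl => commute_of_mem_full_neighborSet a hl)).comp (toSemidirect G Γ s) =
      MonoidHom.id _ from DFunLike.congr_fun h g
  refine hom_ext fun v a => ?_
  rw [MonoidHom.comp_apply, toSemidirect, lift_of, MonoidHom.id_apply]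
  by_cases hv : v = s
  · subst hv
    rw [toSemidirectVertex_self, Subgroup.ofShiftSemidirect_inr]
  · rw [toSemidirectVertex_ne hv, Subgroup.ofShiftSemidirect_inl_of, map_one, one_mul, inv_one,
      mul_one]

/-- The centralizer of a nontrivial element of a vertex group is contained in the full subgroup
on the star of the vertex. -/
theorem mem_full_star_of_commute {s : V} {a : Γ s} (ha : a ≠ 1) {g : GraphProduct G Γ}
    (h : Commute (of G Γ s a) g) : g ∈ full G Γ (insert s (G.neighborSet s)) := by
  obtain ⟨l, hl, b, rfl⟩ := Subgroup.exists_eq_mul_of_commute _ _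
    (fun a _ hl => commute_of_mem_full_neighborSet a hl) _ (ofShiftSemidirect_toSemidirect s)
    (fun a => by rw [toSemidirect, lift_of, toSemidirectVertex_self]) ha h
  exact mul_mem (full_mono (Set.subset_insert _ _) hl) (of_mem_full (Set.mem_insert _ _) _)

/-- If a full subgroup contains a conjugate of a nontrivial element of a vertex group, then it
contains the vertex group, and the conjugating element is in the full subgroup on its vertices and
the star of the vertex. -/
theorem of_conj_mem_full {s : V} {T : Set V} {a : Γ s} (ha : a ≠ 1) {g : GraphProduct G Γ}
    (h : g⁻¹ * of G Γ s a * g ∈ full G Γ T) :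
    s ∈ T ∧ g ∈ full G Γ (insert s (G.neighborSet s) ∪ T) := by
  -- Otherwise the projection to `Γ s` kills the group on `T`, hence a conjugate of `a`.
  have hs : s ∈ T := by
    by_contra hs
    have := proj_eq_one hs h
    rw [map_mul, map_mul, map_inv, proj_of_self, mul_assoc, inv_mul_eq_one] at this
    exact ha (mul_eq_right.1 this.symm)
  refine ⟨hs, ?_⟩
  have h1 := retract_eq_self h
  rw [map_mul, map_mul, map_inv, retract_of_mem hs] at h1
  -- The retraction `r` of `g` satisfies `r⁻¹ a r = g⁻¹ a g`, so `g r⁻¹` centralizes `a`.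
  have h2 : Commute (of G Γ s a) (g * (retract T g)⁻¹) := by
    rw [commute_iff_eq]
    calc of G Γ s a * (g * (retract T g)⁻¹)
        = g * (g⁻¹ * of G Γ s a * g) * (retract T g)⁻¹ := by group
      _ = g * (retract T g)⁻¹ * of G Γ s a := by rw [← h1]; group
  have h3 := mul_mem (full_mono Set.subset_union_left (mem_full_star_of_commute ha h2))
    (full_mono (Set.subset_union_right (s := insert s (G.neighborSet s))) (retract_mem T g))
  rwa [inv_mul_cancel_right] at h3

/-- If a full subgroup on `S` has a finite orbit on the left cosets of a full subgroup on `T`, with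
infinite vertex groups, then `S ⊆ T` and the base point of the orbit is in the full subgroup on
`T` and the link of `S`. -/
theorem subset_and_mem_of_finite_orbit [Finite V] [∀ v, Infinite (Γ v)] {S T : Set V}
    {g : GraphProduct G Γ}
    (h : ((fun a => ((a * g : GraphProduct G Γ) : GraphProduct G Γ ⧸ full G Γ T)) ''
      (full G Γ S : Set (GraphProduct G Γ))).Finite) :
    S ⊆ T ∧ g ∈ full G Γ (T ∪ graphLink G S) := by
  have key : ∀ s ∈ S, s ∈ T ∧ g ∈ full G Γ (insert s (G.neighborSet s) ∪ T) := by
    intro s hs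
    -- Pigeonhole: `Γ s` is infinite and the orbit finite, so distinct `a`, `b` send the coset of
    -- `g` to the same coset.
    obtain ⟨a, -, b, -, hab, he⟩ := (Set.infinite_univ (α := Γ s)).exists_ne_map_eq_of_mapsTo
      (f := fun a => ((of G Γ s a * g : GraphProduct G Γ) : GraphProduct G Γ ⧸ full G Γ T))
      (t := (fun a => ((a * g : GraphProduct G Γ) : GraphProduct G Γ ⧸ full G Γ T)) ''
        (full G Γ S : Set (GraphProduct G Γ)))
      (fun a _ => ⟨of G Γ s a, of_mem_full hs a, rfl⟩) h
    have he' := QuotientGroup.eq.1 he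
    refine of_conj_mem_full (a := a⁻¹ * b) (fun h1 => hab (inv_mul_eq_one.1 h1)) ?_
    convert! he' using 1
    rw [map_mul, map_inv]
    group
  have hST : S ⊆ T := fun s hs => (key s hs).1
  refine ⟨hST, full_mono ?_ (mem_full_biInter S.toFinite fun s hs => (key s hs).2)⟩
  -- A vertex outside `T` that lies in the star of `s` or in `T` for each `s ∈ S` differs from every
  -- such `s`, as `S ⊆ T`, so it is adjacent to all of them.
  intro v hv
  rw [Set.mem_iInter₂] at hv
  by_contra hvT
  rw [Set.mem_union, not_or] at hvT
  refine hvT.2 fun s hs => ?_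
  rcases hv s hs with (rfl | h) | h
  · exact absurd (hST hs) hvT.1
  · exact h
  · exact absurd h hvT.1

end GraphProduct

/-! ### Fourier coefficients in group von Neumann algebras -/

section FourierCoefficients

open Filter Topology

variable {K : Type*}

open Classical in
/-- The canonical basis vectors of `ℓ²(K)`. -/
noncomputable def pointMass (g : K) : EllTwo K := lp.single 2 g (1 : ℂ)

open Classical in
theorem pointMass_apply (g h : K) : pointMass g h = if h = g then 1 else 0 := by
  rw [pointMass, lp.single_apply, Pi.single_apply]

theorem hasSum_pointMass (ξ : EllTwo K) : HasSum (fun g => ξ g • pointMass g) ξ := by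
  classical
  convert! lp.hasSum_single (E := fun _ : K => ℂ) (p := 2) (by norm_num) ξ using 2 with g
  rw [pointMass, ← lp.single_smul, smul_eq_mul, mul_one]

theorem hasSum_apply {ι : Type*} {f : ι → EllTwo K} {ξ : EllTwo K} (h : HasSum f ξ) (g : K) :
    HasSum (fun i => f i g) (ξ g) :=
  h.mapL (lp.evalCLM ℂ (fun _ : K => ℂ) 2 g)

theorem ext_pointMass {x y : EllTwo K →L[ℂ] EllTwo K}
    (h : ∀ g, x (pointMass g) = y (pointMass g)) : x = y := by
  ext1 ξ
  have hx := (hasSum_pointMass ξ).mapL x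
  have hy := (hasSum_pointMass ξ).mapL y
  simp only [map_smul, h] at hx hy
  exact hx.unique hy

theorem memlp_two_comp_equiv (e : K ≃ K) (ξ : EllTwo K) : Memℓp (fun h : K => ξ (e h)) 2 := by
  have h := lp.memℓp ξ
  rw [memℓp_gen_iff (by norm_num)] at h ⊢
  exact e.summable_iff.mpr h

/-- The action of a permutation of the group on `ℓ²(K)`. -/
noncomputable def permuteEllTwo (e : K ≃ K) : EllTwo K →ₗᵢ[ℂ] EllTwo K where
  toFun ξ := ⟨fun h => ξ (e h), memlp_two_comp_equiv e ξ⟩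
  map_add' ξ η := by ext h; rfl
  map_smul' c ξ := by ext h; rfl
  norm_map' ξ := by
    rw [lp.norm_eq_tsum_rpow (by norm_num), lp.norm_eq_tsum_rpow (by norm_num)]
    congr 1
    exact e.tsum_eq (fun h => ‖ξ h‖ ^ (2 : ℝ≥0∞).toReal)

@[simp]
theorem permuteEllTwo_apply (e : K ≃ K) (ξ : EllTwo K) (h : K) :
    permuteEllTwo e ξ h = ξ (e h) := rfl

open Classical in
theorem memlp_two_cutoff (A : Set K) (ξ : EllTwo K) :
    Memℓp (fun h : K => if h ∈ A then ξ h else 0) 2 :=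
  (lp.memℓp ξ).mono' fun h => by split_ifs <;> simp

open Classical in
/-- The projection of `ℓ²(K)` to the functions supported in a set. -/
noncomputable def cutoff (A : Set K) : EllTwo K →L[ℂ] EllTwo K :=
  LinearMap.mkContinuous
    { toFun := fun ξ => ⟨fun h => if h ∈ A then ξ h else 0, memlp_two_cutoff A ξ⟩
      map_add' := fun ξ η => by
        ext h
        change (if h ∈ A then ξ h + η h else 0) =
          (if h ∈ A then ξ h else 0) + (if h ∈ A then η h else 0)
        split_ifs <;> simp
      map_smul' := fun c ξ => by
        ext h
        change (if h ∈ A then c * ξ h else 0) = c * (if h ∈ A then ξ h else 0)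
        split_ifs <;> simp } 1 fun ξ => by
    rw [one_mul]
    refine lp.norm_mono (by norm_num) fun h => ?_
    change ‖if h ∈ A then ξ h else 0‖ ≤ ‖ξ h‖
    split_ifs <;> simp

open Classical in
theorem cutoff_apply (A : Set K) (ξ : EllTwo K) (h : K) :
    cutoff A ξ h = if h ∈ A then ξ h else 0 := rfl

theorem tendsto_cutoff (ξ : EllTwo K) :
    Tendsto (fun F : Finset K => ‖ξ - cutoff (F : Set K) ξ‖) atTop (𝓝 0) := by
  classical
  have h := (tendsto_const_nhds (x := ξ)).sub (hasSum_pointMass ξ)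
  rw [sub_self] at h
  have h' := h.norm
  rw [norm_zero] at h'
  refine h'.congr fun F => ?_
  congr 2
  ext k
  rw [cutoff_apply, lp.coeFn_sum, Finset.sum_apply]
  simp only [lp.coeFn_smul, Pi.smul_apply, pointMass_apply, smul_eq_mul, mul_ite, mul_one,
    mul_zero, Finset.sum_ite_eq, Finset.mem_coe]

/-! ### Convolution and the supports of Fourier coefficients -/

variable [Group K]

theorem leftRegularRep_pointMass (g h : K) :
    leftRegularRep K g (pointMass h) = pointMass (g * h) := by
  ext k
  rw [leftRegularRep_apply, pointMass_apply, pointMass_apply]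
  classical exact if_congr inv_mul_eq_iff_eq_mul rfl rfl

theorem mem_subgroupVN_iff {H : Subgroup K} {x : EllTwo K →L[ℂ] EllTwo K} :
    x ∈ subgroupVN H ↔ ∀ y : EllTwo K →L[ℂ] EllTwo K,
      (∀ h ∈ H, leftRegularRep K h * y = y * leftRegularRep K h) → y * x = x * y := by
  rw [← SetLike.mem_coe, coe_subgroupVN, Set.mem_centralizer_iff]
  simp only [Set.mem_centralizer_iff, Set.forall_mem_image, SetLike.mem_coe]

theorem leftRegularRep_mem {H : Subgroup K} {h : K} (hh : h ∈ H) :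
    leftRegularRep K h ∈ subgroupVN H :=
  mem_subgroupVN_iff.2 fun _ hy => (hy h hh).symm

theorem isClosed_subgroupVN (H : Subgroup K) :
    IsClosed (subgroupVN H : Set (EllTwo K →L[ℂ] EllTwo K)) := by
  rw [coe_subgroupVN]
  exact Set.isClosed_centralizer _

/-- Elements of the group von Neumann algebra commute with right translations. -/
theorem apply_pointMass_apply {x : EllTwo K →L[ℂ] EllTwo K} (hx : x ∈ groupVN K) (g h : K) :
    x (pointMass g) h = x (pointMass 1) (h * g⁻¹) := by
  have h1 := mem_subgroupVN_iff.1 hx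
    (permuteEllTwo (Equiv.mulRight g⁻¹)).toContinuousLinearMap fun k _ => by
      ext ξ l
      change ξ (k⁻¹ * l * g⁻¹) = ξ (k⁻¹ * (l * g⁻¹))
      rw [mul_assoc]
  have h2 : permuteEllTwo (Equiv.mulRight g⁻¹) (pointMass 1) = pointMass g := by
    ext l
    rw [permuteEllTwo_apply, pointMass_apply, pointMass_apply, Equiv.coe_mulRight]
    classical exact if_congr mul_inv_eq_one rfl rfl
  have h3 := congrArg (fun z : EllTwo K →L[ℂ] EllTwo K => z (pointMass 1) h) h1
  change x (pointMass 1) (h * g⁻¹) = x (permuteEllTwo (Equiv.mulRight g⁻¹) (pointMass 1)) h at h3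
  rw [h3, h2]

/-- Elements of the group von Neumann algebra act by convolution with their Fourier
coefficients. -/
theorem hasSum_convolution {x : EllTwo K →L[ℂ] EllTwo K} (hx : x ∈ groupVN K) (ξ : EllTwo K)
    (g : K) : HasSum (fun h => ξ h * x (pointMass 1) (g * h⁻¹)) (x ξ g) := by
  have h := hasSum_apply ((hasSum_pointMass ξ).mapL x) g
  refine h.congr_fun fun h => ?_
  rw [map_smul, ← apply_pointMass_apply hx]
  rfl

theorem eq_zero_of_coeff_eq_zero {x : EllTwo K →L[ℂ] EllTwo K} (hx : x ∈ groupVN K)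
    (h : ∀ g, x (pointMass 1) g = 0) : x = 0 := by
  refine ext_pointMass fun g => ?_
  ext k
  rw [apply_pointMass_apply hx, h]
  rfl

/-- The Fourier coefficients of an element of the von Neumann algebra of a subgroup vanish
outside of the subgroup. -/
theorem coeff_eq_zero_of_notMem {H : Subgroup K} {x : EllTwo K →L[ℂ] EllTwo K}
    (hx : x ∈ subgroupVN H) {g : K} (hg : g ∉ H) : x (pointMass 1) g = 0 := by
  -- The projection to `ℓ²(H)` commutes with translations by `H`, hence with `x`, and it fixes the
  -- point mass at `1`.
  have h1 := mem_subgroupVN_iff.1 hx (cutoff H) fun k hk => by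
    ext ξ l
    change cutoff (H : Set K) ξ (k⁻¹ * l) = cutoff (H : Set K) (leftRegularRep K k ξ) l
    rw [cutoff_apply, cutoff_apply, leftRegularRep_apply]
    classical exact if_congr (Subgroup.mul_mem_cancel_left H (H.inv_mem hk)) rfl rfl
  have h2 : cutoff (H : Set K) (pointMass 1) = pointMass 1 := by
    ext l
    rw [cutoff_apply, pointMass_apply]
    split_ifs with h h' h'
    · rfl
    · rfl
    · exact absurd (h' ▸ H.one_mem) h
    · rfl
  have h3 := congrArg (fun z : EllTwo K →L[ℂ] EllTwo K => z (pointMass 1) g) h1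
  change cutoff (H : Set K) (x (pointMass 1)) g = x (cutoff (H : Set K) (pointMass 1)) g at h3
  rw [h2, cutoff_apply] at h3
  exact h3.symm.trans (if_neg hg)

/-- An element of the group von Neumann algebra with Fourier coefficients supported in a subgroup
belongs to the von Neumann algebra of the subgroup. -/
theorem mem_subgroupVN_of_coeff {H : Subgroup K} {x : EllTwo K →L[ℂ] EllTwo K}
    (hx : x ∈ groupVN K) (h : ∀ g ∉ H, x (pointMass 1) g = 0) : x ∈ subgroupVN H := by
  refine mem_subgroupVN_iff.2 fun y hy => ext_pointMass fun a => ?_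
  ext g
  have h1 := hasSum_convolution hx (y (pointMass a)) g
  have h2 := hasSum_apply ((hasSum_pointMass (x (pointMass a))).mapL y) g
  -- Both expansions are reindexed by the argument `p` of the coefficient of `x`, through `h = p⁻¹
  -- g` and `k = p a`. They then agree termwise: for `p ∈ H` since `y` commutes with translation by
  -- `p`, for other `p` since the coefficient vanishes.
  rw [← ((Equiv.inv K).trans (Equiv.mulRight g)).hasSum_iff] at h1
  rw [← (Equiv.mulRight a).hasSum_iff] at h2
  refine h2.unique (h1.congr_fun fun p => ?_)
  change y (x (pointMass a) (p * a) • pointMass (p * a)) g =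
    y (pointMass a) (p⁻¹ * g) * x (pointMass 1) (g * (p⁻¹ * g)⁻¹)
  rw [map_smul, apply_pointMass_apply hx, mul_inv_cancel_right, mul_inv_rev, inv_inv,
    mul_inv_cancel_left, mul_comm]
  change x (pointMass 1) p * y (pointMass (p * a)) g = _
  by_cases hp : p ∈ H
  · congr 1
    rw [← leftRegularRep_pointMass]
    exact (congrArg (fun z : EllTwo K →L[ℂ] EllTwo K => z (pointMass a) g) (hy p hp)).symm
  · rw [h p hp, zero_mul, zero_mul]

/-- Cauchy–Schwarz, as `h ↦ g h⁻¹` permutes the group and so preserves the norm of `η`. -/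
theorem norm_tsum_convolution_le (ξ η : EllTwo K) (g : K) :
    ‖∑' h, ξ h * η (g * h⁻¹)‖ ≤ ‖ξ‖ * ‖η‖ := by
  let e : K ≃ K := (Equiv.inv K).trans (Equiv.mulLeft g)
  have hpq : (2 : ℝ≥0∞).toReal.HolderConjugate (2 : ℝ≥0∞).toReal := by
    simpa using Real.HolderConjugate.two_two
  have h1 := lp.summable_mul hpq ξ (permuteEllTwo e η)
  have h2 := lp.tsum_mul_le_mul_norm' hpq ξ (permuteEllTwo e η)
  rw [LinearIsometry.norm_map] at h2
  refine le_trans ?_ h2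
  refine (norm_tsum_le_tsum_norm (f := fun h => ξ h * η (g * h⁻¹)) ?_).trans_eq ?_
  · simp_rw [norm_mul]
    exact h1
  · simp_rw [norm_mul]
    rfl

/-- A product with an element of the von Neumann algebra of a subgroup has small Fourier
coefficients on the cosets on which the other factor is small. -/
theorem norm_mul_coeff_le {H : Subgroup K} {x b : EllTwo K →L[ℂ] EllTwo K}
    (hx : x ∈ groupVN K) (hb : b ∈ subgroupVN H) {A : Set K} {g : K}
    (hg : ∀ h ∈ H, g * h ∉ A) :
    ‖(x * b) (pointMass 1) g‖ ≤
      ‖b (pointMass 1)‖ * ‖x (pointMass 1) - cutoff A (x (pointMass 1))‖ := by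
  have h1 := (hasSum_convolution hx (b (pointMass 1)) g).tsum_eq
  change _ = (x * b) (pointMass 1) g at h1
  rw [← h1]
  convert! norm_tsum_convolution_le (b (pointMass 1))
    (x (pointMass 1) - cutoff A (x (pointMass 1))) g using 4 with h
  -- The coefficients of `b` live on `H`, and for `h ∈ H` the point `g h⁻¹` is outside `A`, so
  -- cutting off changes no term.
  by_cases hh : h ∈ H
  · rw [lp.coeFn_sub, Pi.sub_apply, cutoff_apply, if_neg (hg _ (H.inv_mem hh)), sub_zero]
  · rw [coeff_eq_zero_of_notMem hb hh, zero_mul, zero_mul]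

/-- If all translates `a x` by elements `a` of `L(H)` are in a finitely generated right
`L(P)`-module, then the coefficients can be chosen with uniformly bounded norms. -/
theorem exists_bounded_coefficients {H P : Subgroup K} {n : ℕ} (x : EllTwo K →L[ℂ] EllTwo K)
    (xs : Fin n → EllTwo K →L[ℂ] EllTwo K)
    (hincl : ∀ a ∈ subgroupVN H, ∃ b : Fin n → EllTwo K →L[ℂ] EllTwo K,
      (∀ k, b k ∈ subgroupVN P) ∧ a * x = ∑ k, xs k * b k) :
    ∃ C : ℝ, 0 ≤ C ∧ ∀ a ∈ subgroupVN H, ∃ b : Fin n → EllTwo K →L[ℂ] EllTwo K,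
      (∀ k, b k ∈ subgroupVN P) ∧ a * x = ∑ k, xs k * b k ∧ ∀ k, ‖b k‖ ≤ C * ‖a‖ := by
  let A : Submodule ℂ (EllTwo K →L[ℂ] EllTwo K) :=
    (subgroupVN H).toStarSubalgebra.toSubalgebra.toSubmodule
  let B : Submodule ℂ (EllTwo K →L[ℂ] EllTwo K) :=
    (subgroupVN P).toStarSubalgebra.toSubalgebra.toSubmodule
  have hA : IsClosed (A : Set (EllTwo K →L[ℂ] EllTwo K)) := isClosed_subgroupVN H
  have hB : IsClosed (B : Set (EllTwo K →L[ℂ] EllTwo K)) := isClosed_subgroupVN P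
  -- The closed space of all solutions `(a, b)`, a Banach space; `hincl` says that it projects onto
  -- `L(H)`, so the open mapping theorem applies.
  let W : Submodule ℂ ((EllTwo K →L[ℂ] EllTwo K) × (Fin n → EllTwo K →L[ℂ] EllTwo K)) :=
    { carrier := {p | p.1 ∈ A ∧ (∀ k, p.2 k ∈ B) ∧ p.1 * x = ∑ k, xs k * p.2 k}
      add_mem' := fun {p q} hp hq => ⟨A.add_mem hp.1 hq.1,
        fun k => B.add_mem (hp.2.1 k) (hq.2.1 k), by
          simp only [Prod.fst_add, Prod.snd_add, Pi.add_apply, add_mul, mul_add,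
            Finset.sum_add_distrib, hp.2.2, hq.2.2]⟩
      zero_mem' := ⟨A.zero_mem, fun k => B.zero_mem, by simp⟩
      smul_mem' := fun c p hp => ⟨A.smul_mem c hp.1, fun k => B.smul_mem c (hp.2.1 k), by
          simp only [Prod.smul_fst, Prod.smul_snd, Pi.smul_apply, smul_mul_assoc, mul_smul_comm,
            hp.2.2, Finset.smul_sum]⟩ }
  have hW : IsClosed (W : Set ((EllTwo K →L[ℂ] EllTwo K) × (Fin n → EllTwo K →L[ℂ] EllTwo K))) := by
    refine (hA.preimage continuous_fst).inter (IsClosed.inter ?_ ?_)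
    · change IsClosed {p : (EllTwo K →L[ℂ] EllTwo K) × (Fin n → EllTwo K →L[ℂ] EllTwo K) |
        ∀ k, p.2 k ∈ B}
      simp only [Set.ofPred_forall]
      exact isClosed_iInter fun k => hB.preimage ((continuous_apply k).comp continuous_snd)
    · exact isClosed_eq (continuous_fst.mul continuous_const) (continuous_finsetSum _ fun k _ =>
        continuous_const.mul ((continuous_apply k).comp continuous_snd))
  have : CompleteSpace A := hA.completeSpace_coe
  have : CompleteSpace W := hW.completeSpace_coe
  let f : W →L[ℂ] A := ((ContinuousLinearMap.fst ℂ _ _).comp W.subtypeL).codRestrict A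
    fun p => p.2.1
  have hf : Function.Surjective f := fun a => by
    obtain ⟨b, hb, hab⟩ := hincl a a.2
    exact ⟨⟨(a, b), a.2, hb, hab⟩, rfl⟩
  obtain ⟨C, hC0, hC⟩ := ContinuousLinearMap.exists_preimage_norm_le (E := W) (F := A) (σ := RingHom.id ℂ) f hf
  refine ⟨C, hC0.le, fun a ha => ?_⟩
  obtain ⟨p, hp, hpC⟩ := hC ⟨a, ha⟩
  have hp' : (p : (EllTwo K →L[ℂ] EllTwo K) × (Fin n → EllTwo K →L[ℂ] EllTwo K)).1 = a :=
    congrArg Subtype.val hp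
  refine ⟨p.1.2, p.2.2.1, hp' ▸ p.2.2.2, fun k => ?_⟩
  exact ((norm_le_pi_norm _ k).trans (norm_snd_le p.1)).trans hpC

/-- If all translates `a x` by elements `a` of `L(H)` are in a finitely generated right
`L(P)`-module, then the Fourier coefficients of `x` are supported on the elements with finite
`H`-orbit on the left cosets of `P`. -/
theorem finite_orbit_of_coeff_ne_zero {H P : Subgroup K} {n : ℕ}
    {x : EllTwo K →L[ℂ] EllTwo K} {xs : Fin n → EllTwo K →L[ℂ] EllTwo K}
    (hxs : ∀ k, xs k ∈ groupVN K)
    (hincl : ∀ a ∈ subgroupVN H, ∃ b : Fin n → EllTwo K →L[ℂ] EllTwo K,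
      (∀ k, b k ∈ subgroupVN P) ∧ a * x = ∑ k, xs k * b k)
    {g : K} (hg : x (pointMass 1) g ≠ 0) :
    ((fun a => ((a * g : K) : K ⧸ P)) '' (H : Set K)).Finite := by
  classical
  by_contra hinf
  obtain ⟨C, hC0, hC⟩ := exists_bounded_coefficients x xs hincl
  have hlim : Tendsto (fun F : Finset K => ∑ k, C * ‖pointMass (1 : K)‖ *
      ‖xs k (pointMass 1) - cutoff (F : Set K) (xs k (pointMass 1))‖) atTop (𝓝 0) := by
    have := tendsto_finsetSum Finset.univ fun k (_ : k ∈ Finset.univ) =>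
      (tendsto_cutoff (xs k (pointMass 1))).const_mul (C * ‖pointMass (1 : K)‖)
    simpa using this
  refine hg (norm_le_zero_iff.1 (ge_of_tendsto' hlim fun F => ?_))
  -- An infinite orbit leaves the finitely many cosets that meet `F`, so `h g P` is disjoint from
  -- `F`.
  obtain ⟨_, ⟨h, hh, rfl⟩, hF⟩ := Set.Infinite.exists_notMem_finset hinf
    (F.image fun a => ((a : K) : K ⧸ P))
  obtain ⟨b, hb, hab, hbC⟩ := hC _ (leftRegularRep_mem hh)
  have hnorm : ‖leftRegularRep K h‖ ≤ 1 := (leftTranslation h).norm_toContinuousLinearMap_le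
  have hbC' : ∀ k, ‖b k‖ ≤ C := fun k => (hbC k).trans (mul_le_of_le_one_right hC0 hnorm)
  have h1 : x (pointMass 1) g = ∑ k, (xs k * b k) (pointMass 1) (h * g) := by
    have h2 := congrArg (fun z : EllTwo K →L[ℂ] EllTwo K => z (pointMass 1) (h * g)) hab
    simp only [_root_.sum_apply, lp.coeFn_sum, Finset.sum_apply] at h2
    rw [← h2]
    change _ = x (pointMass 1) (h⁻¹ * (h * g))
    rw [inv_mul_cancel_left]
  rw [h1]
  refine (norm_sum_le _ _).trans (Finset.sum_le_sum fun k _ => ?_)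
  refine (norm_mul_coeff_le (A := (F : Set K)) (hxs k) (hb k) fun p hp hpF => hF ?_).trans ?_
  · refine Finset.mem_image.2 ⟨_, hpF, ?_⟩
    rw [QuotientGroup.mk_mul_of_mem _ hp]
  · gcongr
    exact (b k).le_of_opNorm_le (hbC' k) _

end FourierCoefficients

theorem mainTheorem12 {V : Type*} [Finite V] (G : SimpleGraph V)
    (Γ : V → Type*) [∀ v, Group (Γ v)] [∀ v, Infinite (Γ v)]
    (S T : Set V) (n : ℕ)
    (x : EllTwo (GraphProduct G Γ) →L[ℂ] EllTwo (GraphProduct G Γ))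
    (xs : Fin n → EllTwo (GraphProduct G Γ) →L[ℂ] EllTwo (GraphProduct G Γ))
    (hx : x ∈ groupVN (GraphProduct G Γ))
    (hxs : ∀ k, xs k ∈ groupVN (GraphProduct G Γ))
    (hx0 : x ≠ 0)
    (hincl : ∀ a ∈ subgroupVN (GraphProduct.full G Γ S),
      ∃ b : Fin n → EllTwo (GraphProduct G Γ) →L[ℂ] EllTwo (GraphProduct G Γ),
        (∀ k, b k ∈ subgroupVN (GraphProduct.full G Γ T)) ∧ a * x = ∑ k, xs k * b k) :
    S ⊆ T ∧ x ∈ subgroupVN (GraphProduct.full G Γ (T ∪ graphLink G S)) := by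
  have key : ∀ g, x (pointMass 1) g ≠ 0 →
      S ⊆ T ∧ g ∈ GraphProduct.full G Γ (T ∪ graphLink G S) := fun g hg =>
    GraphProduct.subset_and_mem_of_finite_orbit (finite_orbit_of_coeff_ne_zero hxs hincl hg)
  constructor
  · by_contra hST
    exact hx0 (eq_zero_of_coeff_eq_zero hx fun g => by
      by_contra hg
      exact hST (key g hg).1)
  · exact mem_subgroupVN_of_coeff hx fun g hg => by
      by_contra hg'
      exact hg (key g hg').2
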